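/- Let $\mathbb{K}$ be a field, $S=\mathbb{K}[x_1,\dots,x_n]$ and $E=\bigoplus_{c\in\mathbb{Z}^n}E_c$ a finitely generated reflexive $\mathbb{Z}^n$-graded $S$-module. Order $\mathbb{Z}^n$ and $\bar{\mathbb{Z}}^n=(\mathbb{Z}\cup\{-\infty,\infty\})^n$ componentwise. Let $\mathbf{E}=\varinjlim_{c\in\mathbb{Z}^n}E_c$ be the colimit along multiplication by monomials, and for $1\le k\le n$, $i\in\mathbb{Z}$ let $E^k(i)\subseteq\mathbf{E}$ be the sum of the images of all $E_c$ with $c_k=i$; these are the filtrations of $\mathbf{E}$ associated with $E$. Call $i$ a jump of $E^k$ if $E^k(i-1)\subsetneq E^k(i)$. Let $\mathcal{V}_E$ be the set of all intersections of subspaces $E^k(i)$, $1\le k\le n$, $i$ a jump of $E^k$ (including the empty intersection $\mathbf{E}$), ordered by inclusion, and for $X\in\mathcal{V}_E$ put $\underline{i}^X=(i^X_1,\dots,i^X_n)$ with $i^X_k=\min\{i \text{ a jump of } E^k\mid X\subseteq E^k(i)\}$ (for $E=0$ there are no jumps and we put $\underline{i}^{X}=0$). An lcm-lattice is a subset $\mathcal{L}\subseteq\bar{\mathbb{Z}}^n$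 closed under componentwise maxima all of whose elements have all components $<\infty$. Extend $E$ to $\bar{\mathbb{Z}}^n$ by $\bar E_p=\varprojlim_{c\in\mathbb{Z}^n,\,c\ge p}E_c$ (zero if there is no such $c$), and let $\operatorname{zip}^{\mathcal{L}}E$ be the restriction of $\bar E$ to the poset $\mathcal{L}$. For a $\mathbb{K}$-linear representation $F$ of $\mathcal{L}$ let $\operatorname{unzip}^{\mathcal{L}}F$ be the representation of $\mathbb{Z}^n$ whose value at $c$ is $F_{\max(c)}$, where $\max(c)$ is the greatest element of $\{p\in\mathcal{L}\mid p\le c\}$, and $0$ if that set is empty, with the maps induced by $F$ (and zero maps from zero spaces). The lcm-lattice $\mathcal{L}$ is $E$-admissible if $E\cong\operatorname{unzip}^{\mathcal{L}}\operatorname{zip}^{\mathcal{L}}E$ as representations of $\mathbb{Z}^n$ (equivalently, as $\mathbb{Z}^n$-graded $S$-modules). Proposition. (1) If $E\neq0$, the minima defining $\underline{i}^X$ exist for every $X\in\mathcal{V}_E$. For all $X,Y\in\mathcal{V}_E$ we have $\underline{i}^X\le\underline{i}^Y$ if and only if $X\subseteq Y$; so $X\mapsto\underline{i}^X$ embeds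 the poset $\mathcal{V}_E$ into $\mathbb{Z}^n$. (2) The image $\{\underline{i}^X\mid X\in\mathcal{V}_E\}$ is an $E$-admissible lcm-lattice. (3) The image $\{\underline{i}^X\mid 0\neq X\in\mathcal{V}_E\}$ of the nonzero elements is a minimal $E$-admissible lcm-lattice: it is an $E$-admissible lcm-lattice, and none of its proper subsets is one. In particular, if $0\notin\mathcal{V}_E$, then the image of $\mathcal{V}_E$ itself is a minimal $E$-admissible lcm-lattice. -/

import Mathlib

universe u v

/-- The poset `ℤⁿ` with its componentwise order. -/
abbrev ZVec (n : ℕ) : Type := Fin n → ℤ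

/-- The poset `(ℤ ∪ {-∞, ∞})ⁿ` with its componentwise order; the join `⊔` is the lcm. -/
abbrev ZBar (n : ℕ) : Type := Fin n → WithBot (WithTop ℤ)

/-- The inclusion of `ℤⁿ` into `(ℤ ∪ {-∞, ∞})ⁿ`. -/
def ZVec.toBar {n : ℕ} (c : ZVec n) : ZBar n := fun k => ((c k : WithTop ℤ) : WithBot (WithTop ℤ))

theorem ZVec.toBar_mono {n : ℕ} : Monotone (ZVec.toBar (n := n)) := by
  intro c d h k
  exact WithBot.coe_le_coe.2 (WithTop.coe_le_coe.2 (h k))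

/-! ### Graded modules and the representations of `ℤⁿ` they define -/

section Graded

variable (K : Type u) [Field K] (n : ℕ) (E : Type v) [AddCommGroup E] [Module K E]
  [Module (MvPolynomial (Fin n) K) E]

/-- A `ℤⁿ`-grading of a module `E` over `S = K[x₁, …, xₙ]`: a direct sum decomposition
`E = ⨁ E_c` into `K`-subspaces such that `x^a E_c ⊆ E_{c + a}` for every monomial `x^a`. -/
structure ZnGrading where
  piece : ZVec n → Submodule K E
  isInternal : DirectSum.IsInternal piece
  monomial_smul_mem : ∀ (a : Fin n →₀ ℕ) (c : ZVec n) (e : E), e ∈ piece c →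
    (MvPolynomial.monomial a (1 : K)) • e ∈ piece (fun k => c k + (a k : ℤ))

end Graded

/-- The exponent `d - c` of the monomial `x^(d - c)`, for `c ≤ d` in `ℤⁿ`. -/
noncomputable def expDiff {n : ℕ} (c d : ZVec n) : Fin n →₀ ℕ :=
  Finsupp.equivFunOnFinite.symm (fun k => (d k - c k).toNat)

theorem expDiff_apply {n : ℕ} (c d : ZVec n) (k : Fin n) :
    expDiff c d k = (d k - c k).toNat := rfl

theorem expDiff_self {n : ℕ} (c : ZVec n) : expDiff c c = 0 := by
  ext k
  simp [expDiff_apply]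

theorem expDiff_add {n : ℕ} {b c d : ZVec n} (h : b ≤ c) (h' : c ≤ d) :
    expDiff c d + expDiff b c = expDiff b d := by
  ext k
  have h1 : b k ≤ c k := h k
  have h2 : c k ≤ d k := h' k
  simp only [Finsupp.add_apply, expDiff_apply]
  omega

/-! ### Linear representations of posets -/

/-- A `K`-linear representation of a preordered set `P`, that is, a functor from `P` to
`K`-vector spaces. -/
structure PosetRep (K : Type u) [Field K] (P : Type) [Preorder P] where
  obj : P → Type v
  [addCommGroup : ∀ x, AddCommGroup (obj x)]
  [module : ∀ x, Module K (obj x)]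
  map : ∀ {x y : P}, x ≤ y → (obj x →ₗ[K] obj y)
  map_refl : ∀ (x : P) (e : obj x), map (le_refl x) e = e
  map_trans : ∀ {x y z : P} (h : x ≤ y) (h' : y ≤ z) (e : obj x),
    map h' (map h e) = map (h.trans h') e

attribute [instance] PosetRep.addCommGroup PosetRep.module

/-- An isomorphism of representations: a natural family of linear isomorphisms. -/
structure PosetRep.Iso {K : Type u} [Field K] {P : Type} [Preorder P]
    (F F' : PosetRep.{u, v} K P) where
  equiv : ∀ x, F.obj x ≃ₗ[K] F'.obj x
  naturality : ∀ {x y : P} (h : x ≤ y) (e : F.obj x),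
    equiv y (F.map h e) = F'.map h (equiv x e)

/-- The pullback of a representation along a monotone map. -/
def PosetRep.comap {K : Type u} [Field K] {P Q : Type} [Preorder P] [Preorder Q] {f : P → Q}
    (hf : Monotone f) (F : PosetRep.{u, v} K Q) : PosetRep.{u, v} K P where
  obj x := F.obj (f x)
  map h := F.map (hf h)
  map_refl x e := F.map_refl (f x) e
  map_trans h h' e := F.map_trans (hf h) (hf h') e

section Rep

variable {K : Type u} [Field K] {n : ℕ} {E : Type v} [AddCommGroup E] [Module K E]
  [Module (MvPolynomial (Fin n) K) E]

theorem ZnGrading.smul_mem_piece (G : ZnGrading K n E) {c d : ZVec n} (h : c ≤ d) {e : E}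
    (he : e ∈ G.piece c) : (MvPolynomial.monomial (expDiff c d) (1 : K)) • e ∈ G.piece d := by
  have h1 := G.monomial_smul_mem (expDiff c d) c e he
  have h2 : (fun k => c k + ((expDiff c d k : ℕ) : ℤ)) = d := by
    funext k
    have : c k ≤ d k := h k
    rw [expDiff_apply]
    omega
  rwa [h2] at h1

variable [IsScalarTower K (MvPolynomial (Fin n) K) E]

/-- Multiplication by `x^(d - c)` as a `K`-linear map `E_c → E_d`, for `c ≤ d`. -/
noncomputable def ZnGrading.mulMap (G : ZnGrading K n E) {c d : ZVec n} (h : c ≤ d) :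
    G.piece c →ₗ[K] G.piece d where
  toFun e := ⟨(MvPolynomial.monomial (expDiff c d) (1 : K)) • (e : E), G.smul_mem_piece h e.2⟩
  map_add' e e' := by
    ext
    simp
  map_smul' r e := by
    apply Subtype.ext
    exact smul_comm _ r (e : E)

/-- The representation `c ↦ E_c` of the poset `ℤⁿ` given by a `ℤⁿ`-graded `S`-module. -/
noncomputable def ZnGrading.rep (G : ZnGrading K n E) : PosetRep.{u, v} K (ZVec n) where
  obj c := G.piece c
  map h := G.mulMap h
  map_refl c e := by
    apply Subtype.ext
    change (MvPolynomial.monomial (expDiff c c) (1 : K)) • (e : E) = (e : E)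
    rw [expDiff_self]
    exact one_smul _ _
  map_trans {b c d} h h' e := by
    apply Subtype.ext
    change (MvPolynomial.monomial (expDiff c d) (1 : K)) •
        ((MvPolynomial.monomial (expDiff b c) (1 : K)) • (e : E)) =
      (MvPolynomial.monomial (expDiff b d) (1 : K)) • (e : E)
    rw [smul_smul, MvPolynomial.monomial_mul, expDiff_add h h', one_mul]

end Rep

/-! ### lcm-lattices, zip, unzip, and admissibility -/

/-- An lcm-lattice: a subset of `(ℤ ∪ {-∞, ∞})ⁿ` which is closed under lcm and all of whose
elements have all their components `< ∞`. -/
structure IsLcmLattice {n : ℕ} (L : Set (ZBar n)) : Prop where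
  sup_mem : ∀ p ∈ L, ∀ q ∈ L, p ⊔ q ∈ L
  lt_top : ∀ p ∈ L, ∀ k, p k < ⊤

section Lattice

variable {n : ℕ} {L : Set (ZBar n)}

theorem exists_max_of_le_coe (T : Set (WithBot (WithTop ℤ))) (hT : T.Nonempty) (b : ℤ)
    (hb : ∀ t ∈ T, t ≤ ((b : WithTop ℤ) : WithBot (WithTop ℤ))) : ∃ t ∈ T, ∀ s ∈ T, s ≤ t := by
  by_cases h : ∃ z : ℤ, ((z : WithTop ℤ) : WithBot (WithTop ℤ)) ∈ T
  · obtain ⟨m, hm, hmax⟩ := Int.exists_greatest_of_bdd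
      (P := fun z : ℤ => ((z : WithTop ℤ) : WithBot (WithTop ℤ)) ∈ T)
      ⟨b, fun z hz => WithTop.coe_le_coe.1 (WithBot.coe_le_coe.1 (hb _ hz))⟩ h
    refine ⟨_, hm, fun s hs => ?_⟩
    induction s with
    | bot => exact bot_le
    | coe s =>
      induction s with
      | top => exact absurd (WithBot.coe_le_coe.1 (hb _ hs)) (by simp)
      | coe s => exact WithBot.coe_le_coe.2 (WithTop.coe_le_coe.2 (hmax s hs))
  · obtain ⟨t, ht⟩ := hT
    refine ⟨t, ht, fun s hs => ?_⟩
    induction s with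
    | bot => exact bot_le
    | coe s =>
      induction s with
      | top => exact absurd (WithBot.coe_le_coe.1 (hb _ hs)) (by simp)
      | coe s => exact absurd ⟨s, hs⟩ h

/-- If some element of an lcm-lattice is `≤ c ∈ ℤⁿ`, there is a greatest such element. -/
theorem IsLcmLattice.exists_isGreatest (hL : IsLcmLattice L) (c : ZVec n)
    (h : ∃ p ∈ L, p ≤ c.toBar) : ∃ q, IsGreatest {p | p ∈ L ∧ p ≤ c.toBar} q := by
  obtain ⟨p₀, hp₀, hp₀c⟩ := h
  have key : ∀ k : Fin n, ∃ p ∈ {p | p ∈ L ∧ p ≤ c.toBar},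
      ∀ q ∈ {p | p ∈ L ∧ p ≤ c.toBar}, q k ≤ p k := by
    intro k
    obtain ⟨t, ⟨p, hp, rfl⟩, hmax⟩ := exists_max_of_le_coe
      ((fun p : ZBar n => p k) '' {p | p ∈ L ∧ p ≤ c.toBar}) ⟨_, p₀, ⟨hp₀, hp₀c⟩, rfl⟩ (c k)
      (by rintro _ ⟨p, hp, rfl⟩; exact hp.2 k)
    exact ⟨p, hp, fun q hq => hmax _ ⟨q, hq, rfl⟩⟩
  choose P hP hmax using key
  have fin : ∀ s : Finset (Fin n), ∃ q ∈ {p | p ∈ L ∧ p ≤ c.toBar}, ∀ k ∈ s, P k ≤ q := by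
    intro s
    induction s using Finset.induction_on with
    | empty => exact ⟨p₀, ⟨hp₀, hp₀c⟩, by simp⟩
    | insert a s _ ih =>
      obtain ⟨q, hq, hqs⟩ := ih
      refine ⟨P a ⊔ q, ⟨hL.sup_mem _ (hP a).1 _ hq.1, sup_le (hP a).2 hq.2⟩, fun k hk => ?_⟩
      rcases Finset.mem_insert.1 hk with rfl | hk
      · exact le_sup_left
      · exact (hqs k hk).trans le_sup_right
  obtain ⟨q, hq, hqP⟩ := fin Finset.univ
  exact ⟨q, hq, fun p hp k => (hmax k p hp).trans (hqP k (Finset.mem_univ k) k)⟩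

open Classical in
/-- The greatest element `max(c)` of `{p ∈ L | p ≤ c}`, and `⊥` if this set is empty. -/
noncomputable def IsLcmLattice.max (hL : IsLcmLattice L) (c : ZVec n) : WithBot L :=
  if h : ∃ p ∈ L, p ≤ c.toBar then
    ((⟨(hL.exists_isGreatest c h).choose, (hL.exists_isGreatest c h).choose_spec.1.1⟩ : L) :
      WithBot L)
  else ⊥

theorem IsLcmLattice.max_mono (hL : IsLcmLattice L) : Monotone hL.max := by
  intro c d hcd
  by_cases hc : ∃ p ∈ L, p ≤ c.toBar
  · have hd : ∃ p ∈ L, p ≤ d.toBar := by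
      obtain ⟨p, hp, hpc⟩ := hc
      exact ⟨p, hp, hpc.trans (ZVec.toBar_mono hcd)⟩
    rw [IsLcmLattice.max, IsLcmLattice.max, dif_pos hc, dif_pos hd, WithBot.coe_le_coe]
    have h1 := (hL.exists_isGreatest c hc).choose_spec.1
    exact (hL.exists_isGreatest d hd).choose_spec.2 ⟨h1.1, h1.2.trans (ZVec.toBar_mono hcd)⟩
  · rw [IsLcmLattice.max, dif_neg hc]
    exact bot_le

end Lattice

section Zip

variable {K : Type u} [Field K] {n : ℕ}

/-- The inverse limit of the spaces `E_c` over all `c ∈ ℤⁿ` with `p ≤ c`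
(it is zero if there is no such `c`). -/
def limitOver (E : PosetRep.{u, v} K (ZVec n)) (p : ZBar n) :
    Submodule K (∀ c : {c : ZVec n // p ≤ c.toBar}, E.obj c.1) where
  carrier := {s | ∀ (c d : {c : ZVec n // p ≤ c.toBar}) (h : c.1 ≤ d.1), E.map h (s c) = s d}
  add_mem' {s t} hs ht c d h := by
    rw [Pi.add_apply, Pi.add_apply, map_add, hs c d h, ht c d h]
  zero_mem' c d h := by
    rw [Pi.zero_apply, Pi.zero_apply, map_zero]
  smul_mem' r s hs c d h := by
    rw [Pi.smul_apply, Pi.smul_apply, map_smul, hs c d h]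

/-- The restriction map between these limits. -/
def limitOverMap (E : PosetRep.{u, v} K (ZVec n)) {p q : ZBar n} (h : p ≤ q) :
    limitOver E p →ₗ[K] limitOver E q where
  toFun s := ⟨fun c => s.1 ⟨c.1, h.trans c.2⟩, fun c d hcd =>
    s.2 ⟨c.1, h.trans c.2⟩ ⟨d.1, h.trans d.2⟩ hcd⟩
  map_add' _ _ := rfl
  map_smul' _ _ := rfl

/-- The extension of a representation of `ℤⁿ` to a representation of `(ℤ ∪ {-∞, ∞})ⁿ`. -/
def barExt (E : PosetRep.{u, v} K (ZVec n)) : PosetRep.{u, v} K (ZBar n) where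
  obj p := limitOver E p
  map h := limitOverMap E h
  map_refl _ _ := rfl
  map_trans _ _ _ := rfl

/-- `zip^L E`: the restriction of the extended representation to the subposet `L`. -/
noncomputable def zip (L : Set (ZBar n)) (E : PosetRep.{u, v} K (ZVec n)) : PosetRep.{u, v} K L :=
  (barExt E).comap (Subtype.mono_coe (· ∈ L))

section ExtendByZero

variable {P : Type} [Preorder P] (F : PosetRep.{u, v} K P)

/-- The space `F_x` for `x ∈ P`, and the zero space for the added bottom element. -/
def zeroExtObj : WithBot P → Type v
  | ⊥ => PUnit.{v + 1}
  | (x : P) => F.obj x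

instance zeroExtAddCommGroup : ∀ x : WithBot P, AddCommGroup (zeroExtObj F x)
  | ⊥ => inferInstanceAs (AddCommGroup PUnit.{v + 1})
  | (x : P) => inferInstanceAs (AddCommGroup (F.obj x))

instance zeroExtModule : ∀ x : WithBot P, Module K (zeroExtObj F x)
  | ⊥ => inferInstanceAs (Module K PUnit.{v + 1})
  | (x : P) => inferInstanceAs (Module K (F.obj x))

/-- The maps of `F` between elements of `P`, and zero from the added bottom element. -/
def zeroExtMap : ∀ {x y : WithBot P}, x ≤ y → (zeroExtObj F x →ₗ[K] zeroExtObj F y)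
  | ⊥, _, _ => 0
  | (x : P), (y : P), h => (F.map (WithBot.coe_le_coe.1 h) : F.obj x →ₗ[K] F.obj y)
  | (_ : P), ⊥, h => absurd h (WithBot.not_coe_le_bot _)

/-- Extension of a representation of `P` by zero to `P` with a bottom element added. -/
def extendByZero : PosetRep.{u, v} K (WithBot P) where
  obj := zeroExtObj F
  map h := zeroExtMap F h
  map_refl
    | ⊥, _ => rfl
    | (x : P), e => F.map_refl x e
  map_trans {x y z} h h' e := match x, y, z, h, h', e with
    | ⊥, _, _, _, _, _ => map_zero (zeroExtMap F _)
    | (_ : P), (_ : P), (_ : P), h, h', e =>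
      F.map_trans (WithBot.coe_le_coe.1 h) (WithBot.coe_le_coe.1 h') e
    | (_ : P), ⊥, _, h, _, _ => absurd h (WithBot.not_coe_le_bot _)
    | (_ : P), (_ : P), ⊥, _, h', _ => absurd h' (WithBot.not_coe_le_bot _)

end ExtendByZero

/-- `unzip^L F`, restricted to `ℤⁿ`: its value at `c` is `F_{max(c)}` if there is an element
of `L` which is `≤ c`, and zero otherwise. -/
noncomputable def unzip {L : Set (ZBar n)} (hL : IsLcmLattice L) (F : PosetRep.{u, v} K L) :
    PosetRep.{u, v} K (ZVec n) :=
  (extendByZero F).comap hL.max_mono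

/-- `L` is an `E`-admissible lcm-lattice. -/
def IsAdmissible (E : PosetRep.{u, v} K (ZVec n)) (L : Set (ZBar n)) : Prop :=
  ∃ hL : IsLcmLattice L, Nonempty (E.Iso (unzip hL (zip L E)))

/-! ### The filtrations and their intersection poset -/

/-- The colimit `𝐄` of a representation of `ℤⁿ`. -/
abbrev colim (E : PosetRep.{u, v} K (ZVec n)) : Type v :=
  Module.DirectLimit (fun c => E.obj c) (fun _ _ h => E.map h)

/-- The canonical map `E_c → 𝐄`. -/
noncomputable def toColim (E : PosetRep.{u, v} K (ZVec n)) (c : ZVec n) :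
    E.obj c →ₗ[K] colim E :=
  Module.DirectLimit.of K (ZVec n) (fun c => E.obj c) (fun _ _ h => E.map h) c

/-- The filtration step `E^k(i)`: the subspace of `𝐄` spanned by (in fact the directed union of)
the images of all `E_c` with `c_k = i`. -/
noncomputable def filt (E : PosetRep.{u, v} K (ZVec n)) (k : Fin n) (i : ℤ) :
    Submodule K (colim E) :=
  ⨆ (c : ZVec n) (_ : c k = i), LinearMap.range (toColim E c)

/-- `i` is one of the integers at which the `k`-th filtration jumps. -/
def IsJump (E : PosetRep.{u, v} K (ZVec n)) (k : Fin n) (i : ℤ) : Prop :=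
  filt E k (i - 1) < filt E k i

/-- The subspace arrangement `𝒱_E` of all intersections of the distinct nonzero filtration steps
`E^k(i)`, `i` a jump of the `k`-th filtration; the empty intersection is `𝐄`. -/
def arrangement (E : PosetRep.{u, v} K (ZVec n)) : Set (Submodule K (colim E)) :=
  {X | ∃ T : Set (Fin n × ℤ), (∀ t ∈ T, IsJump E t.1 t.2) ∧ X = ⨅ t ∈ T, filt E t.1 t.2}

/-- The set of jumps `i` of the `k`-th filtration with `X ⊆ E^k(i)`. -/
def jumpsAbove (E : PosetRep.{u, v} K (ZVec n)) (X : Submodule K (colim E)) (k : Fin n) : Set ℤ :=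
  {i | IsJump E k i ∧ X ≤ filt E k i}

/-- The vector `i^X ∈ ℤⁿ` with components `i_k^X = min {i | i a jump of E^k, X ⊆ E^k(i)}`. -/
noncomputable def stepIndex (E : PosetRep.{u, v} K (ZVec n)) (X : Submodule K (colim E)) : ZVec n :=
  fun k => sInf (jumpsAbove E X k)

/-- The image in `ℤⁿ ⊆ (ℤ ∪ {-∞, ∞})ⁿ` of a set of subspaces of `𝐄` under `X ↦ i^X`. -/
noncomputable def stepImage (E : PosetRep.{u, v} K (ZVec n)) (V : Set (Submodule K (colim E))) : Set (ZBar n) :=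
  (fun X => (stepIndex E X).toBar) '' V

end Zip

/-! ### Admissibility through evaluation maps -/

namespace ZVec

variable {n : ℕ}

/-! Reflexivity makes multiplication by monomials injective and identifies `E_c`, inside the
colimit, with the intersection `filtInf E c` of the steps `E^k(c_k)`; finite generation makes every
filtration start at zero and end at the whole colimit. These facts, bundled in `IsFiltered` and
proved in `isFiltered_rep`, reduce the statement to linear algebra.

The maps `X ↦ i^X` and `c ↦ filtInf E c` are both monotone. On the arrangement `filtInf E (i^X) = X`
(`filtInf_stepIndex`), which gives the order embedding. Conversely, if all steps `E^k(c_k)` are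
nonzero, then `Z = filtInf E c` lies in the arrangement and `i^Z ≤ c` (`filtInf_mem_arrangement`);
applied to `c = i^X ⊔ i^Y`, this gives closure under joins.

Admissibility: if `E_c ≠ 0` and `q` is the greatest lattice element below `c`, then `i^Z ≤ q ≤ c`,
so `E_q` and `E_c` both have image `Z`. Minimality: for a smaller admissible lattice and `X ≠ 0`,
the greatest element `i^Y` below `i^X` carries the same space, so `X ≤ Y`, whence `i^X = i^Y`. -/

theorem toBar_le_toBar {c d : ZVec n} : c.toBar ≤ d.toBar ↔ c ≤ d :=
  forall_congr' fun _ => WithBot.coe_le_coe.trans WithTop.coe_le_coe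

theorem toBar_sup (c d : ZVec n) : (c ⊔ d).toBar = c.toBar ⊔ d.toBar := by
  funext k
  exact (WithBot.coe_mono.comp WithTop.coe_mono).map_sup (c k) (d k)

theorem toBar_lt_top (c : ZVec n) (k : Fin n) : c.toBar k < ⊤ :=
  WithBot.coe_lt_coe.2 (WithTop.coe_lt_top (c k))

end ZVec

namespace IsLcmLattice

variable {n : ℕ} {L : Set (ZBar n)}

theorem max_eq_bot (hL : IsLcmLattice L) {c : ZVec n} (h : ¬ ∃ p ∈ L, p ≤ c.toBar) :
    hL.max c = ⊥ :=
  dif_neg h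

theorem max_eq_coe (hL : IsLcmLattice L) {c : ZVec n} {q : L}
    (h : IsGreatest {p | p ∈ L ∧ p ≤ c.toBar} q.1) : hL.max c = q := by
  have hc : ∃ p ∈ L, p ≤ c.toBar := ⟨q.1, h.1.1, h.1.2⟩
  rw [IsLcmLattice.max, dif_pos hc]
  exact congrArg _ (Subtype.ext ((hL.exists_isGreatest c hc).choose_spec.unique h))

theorem le_of_max_eq_coe (hL : IsLcmLattice L) {c : ZVec n} {q : L} (h : hL.max c = q) :
    q.1 ≤ c.toBar := by
  by_cases hc : ∃ p ∈ L, p ≤ c.toBar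
  · obtain ⟨p, hp⟩ := hL.exists_isGreatest c hc
    have := hL.max_eq_coe (q := ⟨p, hp.1.1⟩) hp
    rw [h, WithBot.coe_inj] at this
    rw [this]
    exact hp.1.2
  · rw [hL.max_eq_bot hc] at h
    exact absurd h.symm (WithBot.coe_ne_bot)

end IsLcmLattice

namespace PosetRep

theorem map_bijective_of_eq {K : Type u} [Field K] {P : Type} [Preorder P]
    (F : PosetRep.{u, v} K P) {x y : P} (h : x ≤ y) (hxy : x = y) :
    Function.Bijective (F.map h) := by
  subst hxy
  have : ⇑(F.map h) = id := funext fun e => F.map_refl x e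
  rw [this]
  exact Function.bijective_id

end PosetRep

section Admissible

variable {K : Type u} [Field K] {n : ℕ} {L : Set (ZBar n)} (E : PosetRep.{u, v} K (ZVec n))

/-- An unzipped representation depends on `c` only through `max(c)`, so it is constant on the fibres
of `max`; this obstructs making an admissible lattice smaller. -/
theorem map_bijective_of_max_eq {E : PosetRep.{u, v} K (ZVec n)} {F : PosetRep.{u, v} K L}
    (hL : IsLcmLattice L) (φ : E.Iso (unzip hL F)) {c d : ZVec n} (h : c ≤ d)
    (hcd : hL.max c = hL.max d) : Function.Bijective (E.map h) := by
  have h1 : Function.Bijective ((unzip hL F).map h) :=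
    (extendByZero F).map_bijective_of_eq (hL.max_mono h) hcd
  have h2 : φ.equiv d ∘ E.map h = (unzip hL F).map h ∘ φ.equiv c :=
    funext fun e => φ.naturality h e
  have h3 : Function.Bijective (φ.equiv d ∘ E.map h) := h2 ▸ h1.comp (φ.equiv c).bijective
  exact (Function.Bijective.of_comp_iff' (φ.equiv d).bijective _).1 h3

/-- Evaluation at `c` of the extension by zero of the zipped representation. -/
noncomputable def evalAt (c : ZVec n) : ∀ x : WithBot L, (∀ p : L, x = p → p.1 ≤ c.toBar) →
    (zeroExtObj (zip L E) x →ₗ[K] E.obj c)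
  | ⊥, _ => 0
  | (p : L), h =>
    { toFun := fun s : limitOver E p.1 => s.1 ⟨c, h p rfl⟩
      map_add' := fun _ _ => rfl
      map_smul' := fun _ _ => rfl }

theorem evalAt_naturality {c d : ZVec n} (hcd : c ≤ d) : ∀ (x y : WithBot L) (hxy : x ≤ y)
    (hx : ∀ p : L, x = p → p.1 ≤ c.toBar) (hy : ∀ p : L, y = p → p.1 ≤ d.toBar)
    (s : zeroExtObj (zip L E) x),
    evalAt E d y hy (zeroExtMap (zip L E) hxy s) = E.map hcd (evalAt E c x hx s)
  | ⊥, y, hxy, hx, hy, s => by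
    have h1 : zeroExtMap (zip L E) hxy s = 0 := rfl
    have h2 : evalAt E c ⊥ hx s = 0 := rfl
    rw [h1, h2, map_zero, map_zero]
  | (p : L), (q : L), hxy, hx, hy, s => by
    exact ((show limitOver E p.1 from s).2 ⟨c, hx p rfl⟩
      ⟨d, (hx p rfl).trans (ZVec.toBar_mono hcd)⟩ hcd).symm
  | (_ : L), ⊥, h, _, _, _ => absurd h (WithBot.not_coe_le_bot _)

/-- The index set of the limit has the least element `q`, so the limit is `E_q`, and evaluation at
`c` becomes the map `E_q → E_c`. -/
theorem limitOver_eval_bijective (q : ZVec n) {c : ZVec n} (h : q ≤ c)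
    (hb : Function.Bijective (E.map h)) :
    Function.Bijective (fun s : limitOver E q.toBar => s.1 ⟨c, ZVec.toBar_mono h⟩) := by
  have hs : ∀ s : limitOver E q.toBar, ∀ d : {d : ZVec n // q.toBar ≤ d.toBar},
      s.1 d = E.map (ZVec.toBar_le_toBar.1 d.2) (s.1 ⟨q, le_rfl⟩) :=
    fun s d => (s.2 ⟨q, le_rfl⟩ d _).symm
  constructor
  · intro s t hst
    have h1 : s.1 ⟨q, le_rfl⟩ = t.1 ⟨q, le_rfl⟩ := by
      apply hb.1
      have h2 : s.1 ⟨c, ZVec.toBar_mono h⟩ = t.1 ⟨c, ZVec.toBar_mono h⟩ := hst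
      rwa [hs s, hs t] at h2
    apply Subtype.ext
    funext d
    rw [hs s, hs t, h1]
  · intro e
    obtain ⟨e', rfl⟩ := hb.2 e
    exact ⟨⟨fun d => E.map (ZVec.toBar_le_toBar.1 d.2) e',
      fun d d' hdd => E.map_trans _ hdd e'⟩, rfl⟩

/-- A criterion for admissibility: `E_c` vanishes if there is no element of `L` below `c`, and
otherwise it is identified with `E_q` for the greatest element `q` of `L` below `c`. -/
theorem isAdmissible_of_bijective (hL : IsLcmLattice L)
    (hrange : ∀ p ∈ L, ∃ q : ZVec n, q.toBar = p)
    (h0 : ∀ c : ZVec n, (¬ ∃ p ∈ L, p ≤ c.toBar) → Subsingleton (E.obj c))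
    (h1 : ∀ (q c : ZVec n) (h : q ≤ c), IsGreatest {p | p ∈ L ∧ p ≤ c.toBar} q.toBar →
      Function.Bijective (E.map h)) : IsAdmissible E L := by
  have hbij : ∀ c, Function.Bijective
      (evalAt E c (hL.max c) fun _ hp => hL.le_of_max_eq_coe hp) := by
    intro c
    -- The value `max(c)` is generalized to a variable `x`, since the type of `evalAt` depends on it
    -- and only a variable can be replaced by `⊥` or `q`.
    have key : ∀ (x : WithBot L) (hx : ∀ p : L, x = p → p.1 ≤ c.toBar), hL.max c = x →
        Function.Bijective (evalAt E c x hx) := by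
      intro x hx hmax
      by_cases hc : ∃ p ∈ L, p ≤ c.toBar
      · obtain ⟨p, hp⟩ := hL.exists_isGreatest c hc
        obtain ⟨q, rfl⟩ := hrange p hp.1.1
        have hq := hL.max_eq_coe (q := ⟨q.toBar, hp.1.1⟩) hp
        obtain rfl := hmax.symm.trans hq
        exact limitOver_eval_bijective E q _ (h1 q c (ZVec.toBar_le_toBar.1 hp.1.2) hp)
      · obtain rfl := hmax.symm.trans (hL.max_eq_bot hc)
        have := h0 c hc
        exact ⟨fun _ _ _ => rfl, fun e => ⟨PUnit.unit, Subsingleton.elim _ _⟩⟩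
    exact key _ _ rfl
  let ψ : ∀ c, (unzip hL (zip L E)).obj c ≃ₗ[K] E.obj c := fun c =>
    LinearEquiv.ofBijective (evalAt E c (hL.max c) fun _ hp => hL.le_of_max_eq_coe hp) (hbij c)
  refine ⟨hL, ⟨⟨fun c => (ψ c).symm, fun {c d} hcd e => ?_⟩⟩⟩
  rw [LinearEquiv.symm_apply_eq]
  refine ((evalAt_naturality E hcd _ _ (hL.max_mono hcd)
    (fun _ hp => hL.le_of_max_eq_coe hp) (fun _ hp => hL.le_of_max_eq_coe hp)
    ((ψ c).symm e)).trans ?_).symm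
  exact congrArg (E.map hcd) ((ψ c).apply_symm_apply e)

end Admissible

/-! ### Colimit and filtrations -/

section Filtration

variable {K : Type u} [Field K] {n : ℕ} (E : PosetRep.{u, v} K (ZVec n))

theorem toColim_map {c d : ZVec n} (h : c ≤ d) (e : E.obj c) :
    toColim E d (E.map h e) = toColim E c e :=
  Module.DirectLimit.of_f

theorem exists_toColim (e : colim E) : ∃ c x, toColim E c x = e :=
  Module.DirectLimit.exists_of e

theorem toColim_injective (hinj : ∀ {c d : ZVec n} (h : c ≤ d), Function.Injective (E.map h))
    (c : ZVec n) : Function.Injective (toColim E c) := by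
  have : DirectedSystem E.obj (fun _ _ h => E.map h) :=
    ⟨fun c e => E.map_refl c e, fun _ _ _ h h' e => E.map_trans h h' e⟩
  rw [injective_iff_map_eq_zero]
  intro x hx
  obtain ⟨d, h, hd⟩ := Module.DirectLimit.of.zero_exact (f := fun _ _ h => E.map h) hx
  exact (injective_iff_map_eq_zero _).1 (hinj h) x hd

theorem range_toColim_mono {c d : ZVec n} (h : c ≤ d) :
    LinearMap.range (toColim E c) ≤ LinearMap.range (toColim E d) := by
  rintro _ ⟨e, rfl⟩
  exact ⟨E.map h e, toColim_map E h e⟩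

/-- The degrees with `k`-th coordinate `i` are closed under joins, so the sum of images is a
directed union. -/
theorem mem_filt {k : Fin n} {i : ℤ} {e : colim E} :
    e ∈ filt E k i ↔ ∃ c : ZVec n, c k = i ∧ e ∈ LinearMap.range (toColim E c) := by
  have hne : Nonempty {c : ZVec n // c k = i} := ⟨⟨fun _ => i, rfl⟩⟩
  have hdir : Directed (· ≤ ·)
      (fun c : {c : ZVec n // c k = i} => LinearMap.range (toColim E c.1)) := fun c d =>
    ⟨⟨c.1 ⊔ d.1, by rw [Pi.sup_apply, c.2, d.2, sup_idem]⟩,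
      range_toColim_mono E le_sup_left, range_toColim_mono E le_sup_right⟩
  rw [filt, iSup_subtype', Submodule.mem_iSup_of_directed _ hdir]
  exact ⟨fun ⟨c, hc⟩ => ⟨c.1, c.2, hc⟩, fun ⟨c, hc, he⟩ => ⟨⟨c, hc⟩, he⟩⟩

theorem range_toColim_le_filt (c : ZVec n) (k : Fin n) :
    LinearMap.range (toColim E c) ≤ filt E k (c k) :=
  fun _ he => (mem_filt E).2 ⟨c, rfl, he⟩

theorem filt_mono (k : Fin n) : Monotone (filt E k) := by
  intro i j hij e he
  obtain ⟨c, rfl, hec⟩ := (mem_filt E).1 he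
  refine (mem_filt E).2 ⟨Function.update c k j, Function.update_self .., ?_⟩
  exact range_toColim_mono E (le_update_iff.2 ⟨hij, fun _ _ => le_rfl⟩) hec

/-- The subspace `⋂ₖ E^k(c_k)` of `𝐄`. -/
noncomputable def filtInf (c : ZVec n) : Submodule K (colim E) :=
  ⨅ k, filt E k (c k)

theorem filtInf_mono : Monotone (filtInf E) := fun _ _ h =>
  iInf_mono fun k => filt_mono E k (h k)

theorem range_toColim_le_filtInf (c : ZVec n) : LinearMap.range (toColim E c) ≤ filtInf E c :=
  le_iInf (range_toColim_le_filt E c)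

/-- The properties of the representation of `ℤⁿ` given by a finitely generated reflexive module:
the filtrations are finite and determine the representation. -/
structure IsFiltered : Prop where
  map_injective : ∀ {c d : ZVec n} (h : c ≤ d), Function.Injective (E.map h)
  filtInf_le : ∀ c, filtInf E c ≤ LinearMap.range (toColim E c)
  exists_eq_bot : ∀ k, ∃ i, filt E k i = ⊥
  exists_eq_top : ∀ k, ∃ i, filt E k i = ⊤

end Filtration

/-! ### Jumps, step vectors and the intersection arrangement -/

namespace IsFiltered

variable {K : Type u} [Field K] {n : ℕ} {E : PosetRep.{u, v} K (ZVec n)}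
  {X Y : Submodule K (colim E)}

theorem range_toColim (hE : IsFiltered E) (c : ZVec n) :
    LinearMap.range (toColim E c) = filtInf E c :=
  le_antisymm (range_toColim_le_filtInf E c) (hE.filtInf_le c)

/-- Take the least index with the same step; it exists because the filtration vanishes far down. -/
theorem exists_isJump_le (hE : IsFiltered E) {k : Fin n} {i : ℤ} (h : filt E k i ≠ ⊥) :
    ∃ j ≤ i, IsJump E k j ∧ filt E k j = filt E k i := by
  obtain ⟨lo, hlo⟩ := hE.exists_eq_bot k
  obtain ⟨j, hj, hmin⟩ := Int.exists_least_of_bdd (P := fun j => filt E k j = filt E k i)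
    ⟨lo, fun z hz => le_of_not_gt fun hlt => h (le_bot_iff.1
      (hz.symm.le.trans ((filt_mono E k hlt.le).trans hlo.le)))⟩ ⟨i, rfl⟩
  refine ⟨j, hmin i rfl, lt_of_le_of_ne (filt_mono E k (by omega)) fun hne => ?_, hj⟩
  have := hmin (j - 1) (hne.trans hj)
  omega

/-- The vanishing step bounds the jumps below, and the jump at which the filtration becomes
everything lies above any `X`; hence the `sInf` is a true minimum. -/
theorem isLeast_stepIndex [Nontrivial (colim E)] (hE : IsFiltered E)
    (X : Submodule K (colim E)) (k : Fin n) : IsLeast (jumpsAbove E X k) (stepIndex E X k) := by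
  obtain ⟨lo, hlo⟩ := hE.exists_eq_bot k
  obtain ⟨hi, hhi⟩ := hE.exists_eq_top k
  have hb : BddBelow (jumpsAbove E X k) := by
    refine ⟨lo, fun i hi => le_of_not_gt fun hlt => ?_⟩
    have h1 : filt E k i = ⊥ := le_bot_iff.1 ((filt_mono E k hlt.le).trans hlo.le)
    have h2 := hi.1
    rw [IsJump, h1] at h2
    exact not_lt_bot h2
  have hne : (jumpsAbove E X k).Nonempty := by
    obtain ⟨j, -, hj, hj'⟩ := hE.exists_isJump_le (hhi ▸ top_ne_bot)
    exact ⟨j, hj, (hj'.trans hhi).symm ▸ le_top⟩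
  exact ⟨Int.csInf_mem hne hb, fun i hi => csInf_le hb hi⟩

theorem stepIndex_mono [Nontrivial (colim E)] (hE : IsFiltered E) : Monotone (stepIndex E) :=
  fun X Y h k => (hE.isLeast_stepIndex X k).2
    ⟨(hE.isLeast_stepIndex Y k).1.1, h.trans (hE.isLeast_stepIndex Y k).1.2⟩

theorem le_filtInf_stepIndex [Nontrivial (colim E)] (hE : IsFiltered E)
    (X : Submodule K (colim E)) : X ≤ filtInf E (stepIndex E X) :=
  le_iInf fun k => (hE.isLeast_stepIndex X k).1.2

/-- Every step `E^k(i)` in an intersection defining `X` has `i ≥ i^X_k` by minimality, hence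
contains `E^k(i^X_k)`. -/
theorem filtInf_stepIndex [Nontrivial (colim E)] (hE : IsFiltered E) (hX : X ∈ arrangement E) :
    filtInf E (stepIndex E X) = X := by
  refine le_antisymm ?_ (hE.le_filtInf_stepIndex X)
  obtain ⟨T, hT, hXT⟩ := hX
  conv_rhs => rw [hXT]
  refine le_iInf₂ fun t ht => (iInf_le _ t.1).trans (filt_mono E _ ?_)
  exact (hE.isLeast_stepIndex X t.1).2 ⟨hT t ht, hXT.le.trans (iInf₂_le t ht)⟩

theorem stepIndex_le_iff [Nontrivial (colim E)] (hE : IsFiltered E) (hX : X ∈ arrangement E)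
    (hY : Y ∈ arrangement E) : stepIndex E X ≤ stepIndex E Y ↔ X ≤ Y := by
  refine ⟨fun h => ?_, fun h => hE.stepIndex_mono h⟩
  rw [← hE.filtInf_stepIndex hX, ← hE.filtInf_stepIndex hY]
  exact filtInf_mono E h

/-- Lowering each `c_k` to the jump where its step first appears does not change the intersection.
-/
theorem filtInf_mem_arrangement [Nontrivial (colim E)] (hE : IsFiltered E) {c : ZVec n}
    (hc : ∀ k, filt E k (c k) ≠ ⊥) :
    filtInf E c ∈ arrangement E ∧ stepIndex E (filtInf E c) ≤ c := by
  choose j hjc hj hj' using fun k => hE.exists_isJump_le (hc k)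
  refine ⟨⟨Set.range fun k => (k, j k), ?_, ?_⟩, fun k => ?_⟩
  · rintro _ ⟨k, rfl⟩
    exact hj k
  · rw [iInf_range]
    exact iInf_congr fun k => (hj' k).symm
  · exact ((hE.isLeast_stepIndex _ k).2 ⟨hj k, (iInf_le _ k).trans (hj' k).ge⟩).trans (hjc k)

theorem filtInf_mem_arrangement_of_ne_bot [Nontrivial (colim E)] (hE : IsFiltered E)
    {c : ZVec n} (hc : filtInf E c ≠ ⊥) :
    filtInf E c ∈ arrangement E ∧ stepIndex E (filtInf E c) ≤ c :=
  hE.filtInf_mem_arrangement fun k hk => hc (le_bot_iff.1 ((iInf_le _ k).trans hk.le))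

theorem exists_stepIndex_eq_sup [Nontrivial (colim E)] (hE : IsFiltered E)
    (X Y : Submodule K (colim E)) :
    ∃ Z ∈ arrangement E, X ≤ Z ∧ Y ≤ Z ∧ stepIndex E Z = stepIndex E X ⊔ stepIndex E Y := by
  have hjump : ∀ k, filt E k (stepIndex E X k) ≠ ⊥ := fun k =>
    (bot_le.trans_lt (hE.isLeast_stepIndex X k).1.1).ne'
  obtain ⟨h1, h2⟩ := hE.filtInf_mem_arrangement (c := stepIndex E X ⊔ stepIndex E Y)
    fun k hk => hjump k (le_bot_iff.1 ((filt_mono E k le_sup_left).trans hk.le))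
  have hX := (hE.le_filtInf_stepIndex X).trans
    (filtInf_mono E (le_sup_left (b := stepIndex E Y)))
  have hY := (hE.le_filtInf_stepIndex Y).trans
    (filtInf_mono E (le_sup_right (a := stepIndex E X)))
  exact ⟨_, h1, hX, hY,
    le_antisymm h2 (sup_le (hE.stepIndex_mono hX) (hE.stepIndex_mono hY))⟩

/-! ### Admissibility of the image, with or without the zero subspace -/

section StepImage

variable {V : Set (Submodule K (colim E))}

theorem isLcmLattice_stepImage [Nontrivial (colim E)] (hE : IsFiltered E)
    (hV : ∀ X ∈ arrangement E, X ≠ ⊥ → X ∈ V) : IsLcmLattice (stepImage E V) := by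
  constructor
  · rintro _ ⟨X, hX, rfl⟩ _ ⟨Y, hY, rfl⟩
    obtain ⟨Z, hZ, hXZ, hYZ, hsup⟩ := hE.exists_stepIndex_eq_sup X Y
    -- `Z` contains `X` and `Y`, so it can be zero, and possibly missing from `V`, only if `X = Y =
    -- ⊥`.
    by_cases hZ0 : Z = ⊥
    · have hXY : X = Y := (le_bot_iff.1 (hZ0 ▸ hXZ)).trans (le_bot_iff.1 (hZ0 ▸ hYZ)).symm
      exact ⟨Y, hY, by simp [hXY]⟩
    · exact ⟨Z, hV Z hZ hZ0, by simp only [hsup, ZVec.toBar_sup]⟩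
  · rintro _ ⟨X, -, rfl⟩ k
    exact ZVec.toBar_lt_top _ k

theorem isAdmissible_stepImage [Nontrivial (colim E)] (hE : IsFiltered E)
    (hVA : V ⊆ arrangement E) (hV : ∀ X ∈ arrangement E, X ≠ ⊥ → X ∈ V) :
    IsAdmissible E (stepImage E V) := by
  have hinj : ∀ c, Function.Injective (toColim E c) := toColim_injective E hE.map_injective
  have hne : ∀ (c : ZVec n) (e : E.obj c), e ≠ 0 →
      filtInf E c ∈ V ∧ stepIndex E (filtInf E c) ≤ c := by
    intro c e he
    have h0 : filtInf E c ≠ ⊥ := fun h => he <| (injective_iff_map_eq_zero _).1 (hinj c) e <|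
      (Submodule.mem_bot K).1 (h ▸ range_toColim_le_filtInf E c ⟨e, rfl⟩)
    have h1 := hE.filtInf_mem_arrangement_of_ne_bot h0
    exact ⟨hV _ h1.1 h0, h1.2⟩
  refine isAdmissible_of_bijective E (hE.isLcmLattice_stepImage hV) ?_ ?_ ?_
  · rintro _ ⟨X, -, rfl⟩
    exact ⟨_, rfl⟩
  · intro c hc
    refine subsingleton_of_forall_eq 0 fun e => ?_
    by_contra he
    obtain ⟨h1, h2⟩ := hne c e he
    exact hc ⟨_, ⟨_, h1, rfl⟩, ZVec.toBar_mono h2⟩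
  · intro q c hqc hq
    refine ⟨hE.map_injective hqc, fun e => ?_⟩
    by_cases he : e = 0
    · exact ⟨0, by rw [he, map_zero]⟩
    obtain ⟨h1, h2⟩ := hne c e he
    have h3 : stepIndex E (filtInf E c) ≤ q :=
      ZVec.toBar_le_toBar.1 (hq.2 ⟨⟨_, h1, rfl⟩, ZVec.toBar_mono h2⟩)
    have h4 : filtInf E c ≤ LinearMap.range (toColim E q) :=
      (hE.filtInf_stepIndex (hVA h1)).ge.trans ((filtInf_mono E h3).trans (hE.filtInf_le q))
    obtain ⟨e', he'⟩ := h4 (range_toColim_le_filtInf E c ⟨e, rfl⟩)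
    exact ⟨e', hinj c (by rw [toColim_map, he'])⟩

end StepImage

theorem stepImage_subset_of_isAdmissible [Nontrivial (colim E)] (hE : IsFiltered E)
    {L : Set (ZBar n)} (hL : IsAdmissible E L) (hsub : L ⊆ stepImage E (arrangement E \ {⊥})) :
    stepImage E (arrangement E \ {⊥}) ⊆ L := by
  rintro _ ⟨X, ⟨hX, hX0⟩, rfl⟩
  obtain ⟨hLat, ⟨φ⟩⟩ := hL
  have hrange : LinearMap.range (toColim E (stepIndex E X)) = X := by
    rw [hE.range_toColim, hE.filtInf_stepIndex hX]
  have hex : ∃ p ∈ L, p ≤ (stepIndex E X).toBar := by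
    by_contra hno
    refine hX0 ?_
    have hsub : Subsingleton ((unzip hLat (zip L E)).obj (stepIndex E X)) := by
      change Subsingleton (zeroExtObj (zip L E) (hLat.max (stepIndex E X)))
      rw [hLat.max_eq_bot hno]
      exact inferInstanceAs (Subsingleton PUnit)
    have := (φ.equiv (stepIndex E X)).toEquiv.subsingleton
    rw [Set.mem_singleton_iff, ← hrange, LinearMap.range_eq_bot]
    exact LinearMap.ext fun e => by rw [Subsingleton.elim e 0, map_zero, map_zero]
  obtain ⟨q, hq⟩ := hLat.exists_isGreatest _ hex
  obtain ⟨Y, ⟨hY, -⟩, rfl⟩ := hsub hq.1.1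
  have hle : stepIndex E Y ≤ stepIndex E X := ZVec.toBar_le_toBar.1 hq.1.2
  -- Both `i^Y` and `i^X` have greatest lattice element `i^Y`.
  have hbij := map_bijective_of_max_eq hLat φ hle
    ((hLat.max_eq_coe (q := ⟨_, hq.1.1⟩) ⟨⟨hq.1.1, le_rfl⟩, fun p hp => hp.2⟩).trans
      (hLat.max_eq_coe (q := ⟨_, hq.1.1⟩) hq).symm)
  have hXY : X ≤ Y := by
    rw [← hrange, ← hE.filtInf_stepIndex hY, ← hE.range_toColim]
    rintro _ ⟨e, rfl⟩
    obtain ⟨e', rfl⟩ := hbij.2 e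
    exact ⟨e', (toColim_map E hle e').symm⟩
  have : stepIndex E X = stepIndex E Y := le_antisymm (hE.stepIndex_mono hXY) hle
  change (stepIndex E X).toBar ∈ L
  rw [this]
  exact hq.1.1

end IsFiltered

/-! ### The zero module -/

section Subsingleton

variable {K : Type u} [Field K] {n : ℕ} {E : PosetRep.{u, v} K (ZVec n)}

theorem stepIndex_eq_zero [Subsingleton (colim E)] (X : Submodule K (colim E)) :
    stepIndex E X = 0 := by
  funext k
  have : jumpsAbove E X k = ∅ := Set.eq_empty_of_forall_notMem fun i hi =>
    hi.1.ne (Subsingleton.elim _ _)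
  rw [stepIndex, this]
  -- The infimum of the empty set of integers is `0`, matching the convention for `E = 0`.
  exact Int.csInf_empty

theorem isAdmissible_stepImage_of_subsingleton [Subsingleton (colim E)]
    [∀ c, Subsingleton (E.obj c)] (V : Set (Submodule K (colim E))) :
    IsAdmissible E (stepImage E V) := by
  refine isAdmissible_of_bijective E ⟨?_, ?_⟩ ?_ (fun c _ => inferInstance) fun q c h _ =>
    ⟨fun _ _ _ => Subsingleton.elim _ _, fun _ => ⟨0, Subsingleton.elim _ _⟩⟩
  · rintro _ ⟨X, hX, rfl⟩ _ ⟨Y, hY, rfl⟩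
    exact ⟨X, hX, by simp [stepIndex_eq_zero]⟩
  · rintro _ ⟨X, -, rfl⟩ k
    exact ZVec.toBar_lt_top _ k
  · rintro _ ⟨X, -, rfl⟩
    exact ⟨_, rfl⟩

end Subsingleton

/-! ### The representation of a finitely generated reflexive graded module -/

section Reflexive

variable {K : Type u} [Field K] {σ : Type*} {E : Type v} [AddCommGroup E]
  [Module (MvPolynomial σ K) E] [Module.IsReflexive (MvPolynomial σ K) E]

open MvPolynomial in
-- Linear functionals separate points, and they take values in a domain.
theorem monomial_smul_injective (a : σ →₀ ℕ) :
    Function.Injective fun e : E => (monomial a (1 : K)) • e := by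
  have ha : monomial a (1 : K) ≠ 0 := by simp
  intro e e' h
  apply (Module.bijective_dual_eval (MvPolynomial σ K) E).1
  ext1 φ
  refine mul_left_cancel₀ ha ?_
  have := congrArg φ h
  simpa only [map_smul, smul_eq_mul, Module.Dual.eval_apply] using this

open MvPolynomial in
-- A monomial of `p` with too small an exponent in `x_k` would contradict divisibility by the `x^b`
-- chosen for `k`.
theorem MvPolynomial.monomial_dvd_of_forall {a : σ →₀ ℕ} {p : MvPolynomial σ K}
    (h : ∀ k, ∃ b : σ →₀ ℕ, a k ≤ b k ∧ monomial b (1 : K) ∣ p) : monomial a (1 : K) ∣ p := by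
  classical
  rw [monomial_one_dvd_iff_modMonomial_eq_zero]
  ext m
  by_cases hm : a ≤ m
  · rw [coeff_modMonomial_of_le _ hm, coeff_zero]
  · rw [coeff_modMonomial_of_not_le _ hm, coeff_zero]
    obtain ⟨k, hk⟩ := not_forall.1 hm
    obtain ⟨b, hb, q, rfl⟩ := h k
    rw [coeff_monomial_mul', if_neg fun hbm => hk (hb.trans (hbm k))]

open MvPolynomial in
/-- In a reflexive module, an element divisible by monomials whose exponents jointly dominate `a`
is divisible by `x^a`. -/
theorem exists_monomial_smul_eq {a : σ →₀ ℕ} {e : E}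
    (h : ∀ k, ∃ b : σ →₀ ℕ, a k ≤ b k ∧ ∃ e' : E, monomial b (1 : K) • e' = e) :
    ∃ e' : E, monomial a (1 : K) • e' = e := by
  have ha : monomial a (1 : K) ≠ 0 := by simp
  have hdvd : ∀ φ : Module.Dual (MvPolynomial σ K) E, monomial a (1 : K) ∣ φ e := fun φ =>
    monomial_dvd_of_forall fun k => by
      obtain ⟨b, hb, e', rfl⟩ := h k
      exact ⟨b, hb, by rw [map_smul]; exact ⟨φ e', rfl⟩⟩
  choose q hq using hdvd
  -- Dividing all values `φ e` by `x^a` is linear in `φ`; surjectivity onto the bidual turns this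
  -- functional into the quotient element.
  let ψ : Module.Dual (MvPolynomial σ K) (Module.Dual (MvPolynomial σ K) E) :=
    { toFun := q
      map_add' := fun φ φ' => mul_left_cancel₀ ha <| by
        rw [mul_add, ← hq, ← hq, ← hq, LinearMap.add_apply]
      map_smul' := fun r φ => mul_left_cancel₀ ha <| by
        rw [← hq, LinearMap.smul_apply, hq, RingHom.id_apply, smul_eq_mul, smul_eq_mul,
          mul_left_comm] }
  obtain ⟨e', he'⟩ := (Module.bijective_dual_eval (MvPolynomial σ K) E).2 ψ
  refine ⟨e', (Module.bijective_dual_eval (MvPolynomial σ K) E).1 ?_⟩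
  ext1 φ
  have h1 : φ e' = q φ := LinearMap.congr_fun he' φ
  rw [Module.Dual.eval_apply, Module.Dual.eval_apply, map_smul, h1, smul_eq_mul, ← hq]

end Reflexive

/-! ### From the graded module to its filtrations -/

namespace ZnGrading

variable {K : Type u} [Field K] {n : ℕ} {E : Type v} [AddCommGroup E] [Module K E]
  [Module (MvPolynomial (Fin n) K) E] (G : ZnGrading K n E)

/-- The projection of `E` to its component of degree `c`. -/
noncomputable def proj (c : ZVec n) : E →ₗ[K] G.piece c :=
  DirectSum.component K (ZVec n) (fun c => G.piece c) c ∘ₗ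
    (LinearEquiv.ofBijective (DirectSum.coeLinearMap G.piece) G.isInternal).symm.toLinearMap

theorem proj_coe_same {c : ZVec n} (e : G.piece c) : G.proj c e = e :=
  G.isInternal.ofBijective_coeLinearMap_same e

theorem proj_coe_of_ne {c d : ZVec n} (h : c ≠ d) (e : G.piece c) : G.proj d e = 0 :=
  G.isInternal.ofBijective_coeLinearMap_of_ne h e

variable [IsScalarTower K (MvPolynomial (Fin n) K) E]

/-- Finite generation in graded form: `D` collects the degrees of the components of finitely many
generators. A subrepresentation full in those degrees sums to an `S`-submodule `W` containing the
generators, hence to `E`; projecting recovers each degree. -/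
theorem exists_finset_generators [Module.Finite (MvPolynomial (Fin n) K) E] :
    ∃ D : Finset (ZVec n), ∀ P : ∀ c, Submodule K (G.rep.obj c),
      (∀ {c d : ZVec n} (h : c ≤ d), ∀ e ∈ P c, G.rep.map h e ∈ P d) → (∀ d ∈ D, P d = ⊤) →
      ∀ c, P c = ⊤ := by
  classical
  obtain ⟨s, hs⟩ := (Module.Finite.fg_top : (⊤ : Submodule (MvPolynomial (Fin n) K) E).FG)
  have hfin : ∀ e : E, ∃ D : Finset (ZVec n), e ∈ ⨆ c ∈ D, G.piece c := fun e => by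
    rw [← Submodule.mem_iSup_iff_exists_finset, G.isInternal.submodule_iSup_eq_top]
    trivial
  choose D hD using hfin
  refine ⟨s.biUnion D, fun P hP hPD => ?_⟩
  let Q : ∀ c, Submodule K (G.piece c) := P
  have hQ : ∀ {c d : ZVec n} (h : c ≤ d), ∀ e ∈ Q c, G.mulMap h e ∈ Q d := hP
  have hQD : ∀ d ∈ s.biUnion D, Q d = ⊤ := hPD
  let W : Submodule K E := ⨆ c, (Q c).map (G.piece c).subtype
  have hmono : ∀ (a : Fin n →₀ ℕ) (e : E), e ∈ W →
      (MvPolynomial.monomial a (1 : K)) • e ∈ W := by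
    intro a e he
    induction he using Submodule.iSup_induction' with
    | mem c e he =>
      obtain ⟨e, he, rfl⟩ := he
      have hle : c ≤ fun k => c k + (a k : ℤ) := fun k => by simp
      have hexp : expDiff c (fun k => c k + (a k : ℤ)) = a := by
        ext k
        simp [expDiff_apply]
      refine Submodule.mem_iSup_of_mem _ ⟨_, hQ hle e he, ?_⟩
      change MvPolynomial.monomial (expDiff c fun k => c k + (a k : ℤ)) (1 : K) • (e : E) = _
      rw [hexp]
      rfl
    | zero => rw [smul_zero]; exact W.zero_mem
    | add e e' _ _ he he' => rw [smul_add]; exact W.add_mem he he'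
  have hsmul : ∀ (p : MvPolynomial (Fin n) K) (e : E), e ∈ W → p • e ∈ W := by
    intro p e he
    induction p using MvPolynomial.induction_on' with
    | monomial a r =>
      have : MvPolynomial.monomial a r = r • MvPolynomial.monomial a (1 : K) := by
        rw [MvPolynomial.smul_monomial, smul_eq_mul, mul_one]
      rw [this, smul_assoc]
      exact W.smul_mem r (hmono a e he)
    | add p q hp hq => rw [add_smul]; exact W.add_mem hp hq
  have hW : ∀ e : E, e ∈ W := by
    intro e
    have he : e ∈ Submodule.span (MvPolynomial (Fin n) K) (s : Set E) := hs ▸ trivial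
    induction he using Submodule.span_induction with
    | mem e he =>
      refine (iSup₂_le fun c hc => ?_ : ⨆ c ∈ D e, G.piece c ≤ W) (hD e)
      refine le_trans ?_ (le_iSup (fun c => (Q c).map (G.piece c).subtype) c)
      rw [hQD c (Finset.mem_biUnion.2 ⟨e, he, hc⟩), Submodule.map_subtype_top]
    | zero => exact W.zero_mem
    | add e e' _ _ he he' => exact W.add_mem he he'
    | smul p e _ he => exact hsmul p e he
  intro c
  have hproj : ∀ e ∈ W, G.proj c e ∈ Q c := by
    intro e he
    induction he using Submodule.iSup_induction' with
    | mem d e he =>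
      obtain ⟨e, he, rfl⟩ := he
      by_cases hdc : d = c
      · subst hdc
        exact (G.proj_coe_same e).symm ▸ he
      · exact (G.proj_coe_of_ne hdc e).symm ▸ (Q c).zero_mem
    | zero => rw [map_zero]; exact (Q c).zero_mem
    | add e e' _ _ he he' => rw [map_add]; exact (Q c).add_mem he he'
  refine (Submodule.eq_top_iff' (p := Q c)).2 fun e => ?_
  rw [← G.proj_coe_same e]
  exact hproj e (hW e)

theorem exists_filt_eq_bot [Module.Finite (MvPolynomial (Fin n) K) E] (k : Fin n) :
    ∃ i, filt G.rep k i = ⊥ := by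
  classical
  obtain ⟨D, hD⟩ := G.exists_finset_generators
  obtain ⟨lo, hlo⟩ := (D.image fun d => d k).bddBelow
  -- The subrepresentation supported on `c_k ≥ lo` contains all generators, so `E_c = 0` when `c_k =
  -- lo - 1`.
  have key := hD (fun c => if lo ≤ c k then ⊤ else ⊥)
    (fun {c d} h e he => by
      by_cases hc : lo ≤ c k
      · rw [if_pos (hc.trans (h k))]
        trivial
      · rw [if_neg hc, Submodule.mem_bot] at he
        rw [he, map_zero]
        exact Submodule.zero_mem _)
    (fun d hd => if_pos (hlo (Finset.mem_coe.2 (Finset.mem_image_of_mem _ hd))))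
  refine ⟨lo - 1, le_bot_iff.1 (iSup₂_le fun c hc => ?_)⟩
  rintro _ ⟨e, rfl⟩
  have he : e ∈ (⊤ : Submodule K (G.rep.obj c)) := trivial
  rw [← key c, if_neg (by omega), Submodule.mem_bot] at he
  rw [he, map_zero]
  exact Submodule.zero_mem _

theorem exists_filt_eq_top [Module.Finite (MvPolynomial (Fin n) K) E] (k : Fin n) :
    ∃ i, filt G.rep k i = ⊤ := by
  classical
  obtain ⟨D, hD⟩ := G.exists_finset_generators
  obtain ⟨hi, hhi⟩ := (D.image fun d => d k).bddAbove
  have key := hD (fun c => (filt G.rep k hi).comap (toColim G.rep c))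
    (fun {c d} h e he => by
      rw [Submodule.mem_comap] at he ⊢
      rwa [toColim_map])
    (fun d hd => (Submodule.eq_top_iff').2 fun e =>
      filt_mono G.rep k (hhi (Finset.mem_coe.2 (Finset.mem_image_of_mem _ hd)))
        (range_toColim_le_filt G.rep d k ⟨e, rfl⟩))
  refine ⟨hi, (Submodule.eq_top_iff').2 fun e => ?_⟩
  obtain ⟨c, x, rfl⟩ := exists_toColim G.rep e
  have hx : x ∈ (⊤ : Submodule K (G.rep.obj c)) := trivial
  rwa [← key c] at hx

theorem subsingleton_colim [Subsingleton E] : Subsingleton (colim G.rep) :=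
  subsingleton_of_forall_eq 0 fun e => by
    obtain ⟨c, x, rfl⟩ := exists_toColim G.rep e
    have : x = 0 := Subtype.ext (Subsingleton.elim _ _)
    rw [this, map_zero]

variable [Module.IsReflexive (MvPolynomial (Fin n) K) E]

theorem rep_map_injective {c d : ZVec n} (h : c ≤ d) : Function.Injective (G.rep.map h) :=
  fun _ _ hee => Subtype.ext (monomial_smul_injective (K := K) (expDiff c d)
    (congrArg Subtype.val hee))

theorem mem_range_map {c d : ZVec n} (h : c ≤ d) (e : G.rep.obj d)
    (he : ∀ k, ∃ (b : ZVec n) (hb : b ≤ d), b k = c k ∧ e ∈ LinearMap.range (G.rep.map hb)) :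
    e ∈ LinearMap.range (G.rep.map h) := by
  let x : G.piece d := e
  obtain ⟨y, hy⟩ := exists_monomial_smul_eq (K := K) (a := expDiff c d) (e := (x : E)) fun k => by
    obtain ⟨b, hb, hbk, e', he'⟩ := he k
    exact ⟨expDiff b d, by rw [expDiff_apply, expDiff_apply, hbk], _, congrArg Subtype.val he'⟩
  -- The quotient `y` need not be homogeneous; multiplication by `x^(d - c)` sends only its degree
  -- `c` component to degree `d`.
  have key : ∀ y : E, G.proj d (MvPolynomial.monomial (expDiff c d) (1 : K) • y) =
      G.mulMap h (G.proj c y) := by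
    intro y
    have hy : y ∈ ⨆ c, G.piece c := G.isInternal.submodule_iSup_eq_top ▸ trivial
    induction hy using Submodule.iSup_induction' with
    | mem b y hb =>
      have hmem := G.monomial_smul_mem (expDiff c d) b y hb
      by_cases hbc : b = c
      · subst hbc
        rw [G.proj_coe_same ⟨y, hb⟩]
        exact G.proj_coe_same (G.mulMap h ⟨y, hb⟩)
      · rw [G.proj_coe_of_ne hbc ⟨y, hb⟩, map_zero]
        refine G.proj_coe_of_ne (fun hbd => hbc (funext fun k => ?_)) ⟨_, hmem⟩
        have h1 := congrFun hbd k
        have h2 : c k ≤ d k := h k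
        simp only [expDiff_apply] at h1
        omega
    | zero => simp only [smul_zero, map_zero]
    | add y y' _ _ hy hy' => rw [smul_add, map_add, hy, hy', map_add, map_add]
  refine ⟨G.proj c y, ?_⟩
  change G.mulMap h (G.proj c y) = x
  rw [← key, hy, G.proj_coe_same]

theorem isFiltered_rep [Module.Finite (MvPolynomial (Fin n) K) E] : IsFiltered G.rep where
  map_injective := G.rep_map_injective
  exists_eq_bot := G.exists_filt_eq_bot
  exists_eq_top := G.exists_filt_eq_top
  filtInf_le c := by
    intro e he
    obtain ⟨d₀, x₀, rfl⟩ := exists_toColim G.rep e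
    have hk : ∀ k, ∃ b : ZVec n, b k = c k ∧
        toColim G.rep d₀ x₀ ∈ LinearMap.range (toColim G.rep b) := fun k =>
      (mem_filt G.rep).1 ((Submodule.mem_iInf _).1 he k)
    choose b hb x hx using hk
    -- All representatives are moved to the common degree `c ⊔ d₀ ⊔ d₁`, where the `k`-th one
    -- witnesses divisibility in the direction `k`.
    obtain ⟨d₁, hd₁⟩ := (Set.finite_range b).bddAbove
    have h0 : d₀ ≤ c ⊔ d₀ ⊔ d₁ := le_sup_right.trans le_sup_left
    have hc : c ≤ c ⊔ d₀ ⊔ d₁ := le_sup_left.trans le_sup_left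
    have hbd : ∀ k, b k ≤ c ⊔ d₀ ⊔ d₁ := fun k => (hd₁ ⟨k, rfl⟩).trans le_sup_right
    obtain ⟨y, hy⟩ := G.mem_range_map hc (G.rep.map h0 x₀) fun k =>
      ⟨b k, hbd k, hb k, x k, toColim_injective G.rep G.rep_map_injective _
        (by rw [toColim_map, toColim_map, hx])⟩
    exact ⟨y, by rw [← toColim_map G.rep hc, hy, toColim_map]⟩

/-- Each `E_c` embeds in the colimit, so a zero colimit would kill every graded piece. -/
theorem nontrivial_colim [Nontrivial E] : Nontrivial (colim G.rep) := by
  by_contra hno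
  rw [not_nontrivial_iff_subsingleton] at hno
  have hbot : ∀ c, G.piece c = ⊥ := fun c => (Submodule.eq_bot_iff _).2 fun e he =>
    congrArg Subtype.val (toColim_injective G.rep G.rep_map_injective c
      (Subsingleton.elim (toColim G.rep c (⟨e, he⟩ : G.piece c)) (toColim G.rep c 0)))
  have h1 := G.isInternal.submodule_iSup_eq_top
  rw [iSup_eq_bot.2 hbot] at h1
  exact bot_ne_top h1

end ZnGrading

theorem mainTheorem9 {K : Type u} [Field K] {n : ℕ} {E : Type v} [AddCommGroup E] [Module K E]
    [Module (MvPolynomial (Fin n) K) E] [IsScalarTower K (MvPolynomial (Fin n) K) E]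
    [Module.Finite (MvPolynomial (Fin n) K) E] [Module.IsReflexive (MvPolynomial (Fin n) K) E]
    (G : ZnGrading K n E) :
    (Nontrivial E → ∀ X ∈ arrangement G.rep, ∀ k : Fin n,
      IsLeast (jumpsAbove G.rep X k) (stepIndex G.rep X k)) ∧
    (∀ X ∈ arrangement G.rep, ∀ Y ∈ arrangement G.rep,
      stepIndex G.rep X ≤ stepIndex G.rep Y ↔ X ≤ Y) ∧
    IsAdmissible G.rep (stepImage G.rep (arrangement G.rep)) ∧
    Minimal (IsAdmissible G.rep) (stepImage G.rep (arrangement G.rep \ {⊥})) := by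
  have hG := G.isFiltered_rep
  rcases subsingleton_or_nontrivial E with hE | hE
  · have := G.subsingleton_colim
    have hobj : ∀ c, Subsingleton (G.rep.obj c) := fun c =>
      inferInstanceAs (Subsingleton (G.piece c))
    refine ⟨fun h => (not_subsingleton E hE).elim, fun X _ Y _ => ?_,
      isAdmissible_stepImage_of_subsingleton _, isAdmissible_stepImage_of_subsingleton _,
      fun L _ _ => ?_⟩
    · simp only [stepIndex_eq_zero, le_rfl, Subsingleton.elim X Y]
    · rintro _ ⟨X, ⟨-, hX⟩, -⟩
      exact (hX (Subsingleton.elim _ _)).elim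
  · have := G.nontrivial_colim
    exact ⟨fun _ X _ k => hG.isLeast_stepIndex X k,
      fun X hX Y hY => hG.stepIndex_le_iff hX hY,
      hG.isAdmissible_stepImage subset_rfl fun X hX _ => hX,
      hG.isAdmissible_stepImage Set.sdiff_subset fun X hX hX0 => ⟨hX, hX0⟩,
      fun L hL hsub => hG.stepImage_subset_of_isAdmissible hL hsub⟩
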